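/- **Definitions.** A *parity graph* $(V,E,L)$ is a directed graph with countable vertex set $V$, edge set $E\subseteq V\times V$ and edge labelling $L:E\to\mathbb N$ with values ("priorities") in a finite interval. It is *even* if along every infinite path the limit superior of the labels is even. For $F\subseteq E$, $\mathrm{Attr}(F,G)$ is the set of vertices from which every infinite path of $G$ has an edge in $F$; for $W\subseteq V$, $\mathrm{Attr}(W,G)$ is the set of vertices from which every infinite path of $G$ passes by $W$, together with $W$. $G\restriction W$ is the subgraph restricted to the vertices in $W$, and $G\setminus F$ is $G$ without the edges in $F$. An *attractor decomposition* of even level $h$ of a parity graph $G$ with priorities at most $h$ is a tuple $D=(H,A_0,(S_k,A_k,D_k)_{0<k<\ell})$, with $\ell$ an ordinal, such that: $H$ is the set of edges of priority $h$; $A_0=\mathrm{Attr}(H,G)$; for every $0<k<\ell$, with $V_k=V\setminus\bigcup_{j<k}A_j$ and $G_k=(G\setminus H)\restriction V_k$, the set $S_k\subseteq V_k$ is non-empty and closed under successors in $G_k$, $(G\setminus H)\restriction S_k$ has no terminal vertices and only priorities at most $h-2$, $A_k=\mathrm{Attr}(S_k,G_k)$, and $D_k$ is an attractor decomposition of level $h-2$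 of $(G\setminus H)\restriction S_k$; and $V=A_0\cup\bigcup_{0<k<\ell}A_k$. (At level $0$ there are no $S_k$ and $V=A_0$.) Its *tree-shape* is the ordered tree whose root has as children, in order, the tree-shapes of the $D_k$, $0<k<\ell$. For $n\in\mathbb N$, the *$n$-Strahler number* of an ordered tree $T$ of finite depth is $1$ if $T$ is a leaf; otherwise, with $m$ the maximum of the $n$-Strahler numbers of the children of the root, it is $m+1$ if at least $n+1$ of these children have $n$-Strahler number $m$, and $m$ otherwise. The $n$-Strahler number of an attractor decomposition is that of its tree-shape. A labelling $L_I$ of a graph is *$n$-bound* by a labelling $L_J$ of the same graph if there is no finite path segmented into $n+1$ consecutive paths $\pi_0,\dots,\pi_n$ such that, for some odd $p$ and some even $q$, the maximal $L_I$-label of each $\pi_m$ is $p$ and the maximal $L_J$-label of each $\pi_m$ is $q$. **Proposition.** Let $G=(V,E)$ be a finitely branching rooted directed tree without terminal vertices, let $I=[0,2i]$ and $J=[1,2j]$, and let $\rho_I:E\to I$ and $\sigma_J:E\to J$ be labellings such that $(G,\rho_I)$ and $(G,\sigma_J)$ are even. Let $n\in\mathbb N$. If $\rho_I$ is $n$-bound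 by $\sigma_J$, then $(G,\rho_I)$ admits an attractor decomposition, of level $2i$, of $(n+1)$-Strahler number at most $j$. -/

import Mathlib

open Filter

universe u

/-! ### Parity graphs -/

/-- A graph with vertex set `verts`, edge set `edges` and a labelling of its edges by natural
numbers. (Only the values of `label` on `edges` are ever used.) -/
structure ParityGraph (V : Type u) where
  verts : Set V
  edges : Set (V × V)
  edges_subset : edges ⊆ verts ×ˢ verts
  label : V × V → ℕ

/-- The parity graph `(G, L)`: the directed graph `G` with the edge labelling `L`. -/
def ParityGraph.ofDigraph {V : Type u} (G : Digraph V) (L : V × V → ℕ) : ParityGraph V where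
  verts := Set.univ
  edges := {e | G.Adj e.1 e.2}
  edges_subset := fun _ _ => ⟨Set.mem_univ _, Set.mem_univ _⟩
  label := L

/-- The subgraph of `G` restricted to the vertices in `W`. -/
def ParityGraph.restrict {V : Type u} (G : ParityGraph V) (W : Set V) : ParityGraph V where
  verts := G.verts ∩ W
  edges := {e | e ∈ G.edges ∧ e.1 ∈ W ∧ e.2 ∈ W}
  edges_subset := fun _ he =>
    ⟨⟨(G.edges_subset he.1).1, he.2.1⟩, ⟨(G.edges_subset he.1).2, he.2.2⟩⟩
  label := G.label

/-- The graph `G` from which the edges in `F` are removed. -/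
def ParityGraph.deleteEdges {V : Type u} (G : ParityGraph V) (F : Set (V × V)) :
    ParityGraph V where
  verts := G.verts
  edges := G.edges \ F
  edges_subset := fun _ he => G.edges_subset he.1
  label := G.label

/-- `p` is an infinite path of `G`. -/
def ParityGraph.IsInfPath {V : Type u} (G : ParityGraph V) (p : ℕ → V) : Prop :=
  ∀ k, (p k, p (k + 1)) ∈ G.edges

/-- A sequence of priorities is parity accepting if its limit superior is even. -/
def ParityAccepting (c : ℕ → ℕ) : Prop := Even (limsup c atTop)

/-- A parity graph is even if all its infinite paths are parity accepting. -/
def ParityGraph.IsEven {V : Type u} (G : ParityGraph V) : Prop :=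
  ∀ p, G.IsInfPath p → ParityAccepting fun k => G.label (p k, p (k + 1))

/-- All labels of edges of `G` lie in the interval `[a, b]`. -/
def ParityGraph.HasIndex {V : Type u} (G : ParityGraph V) (a b : ℕ) : Prop :=
  ∀ e ∈ G.edges, G.label e ∈ Set.Icc a b

/-- Every vertex of `G` has at least one successor. -/
def ParityGraph.NoTerminal {V : Type u} (G : ParityGraph V) : Prop :=
  ∀ v ∈ G.verts, ∃ w, (v, w) ∈ G.edges

/-- `S` is closed under successors in `G`. -/
def ParityGraph.SuccClosed {V : Type u} (G : ParityGraph V) (S : Set V) : Prop :=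
  ∀ v ∈ S, ∀ w, (v, w) ∈ G.edges → w ∈ S

/-- The attractor of a set of edges: the vertices from which every infinite path has an edge
in `F`. -/
def ParityGraph.attrEdges {V : Type u} (G : ParityGraph V) (F : Set (V × V)) : Set V :=
  {v | v ∈ G.verts ∧ ∀ p, G.IsInfPath p → p 0 = v → ∃ k, (p k, p (k + 1)) ∈ F}

/-- The attractor of a set of vertices: the vertices in `W`, and those from which every infinite
path eventually passes by `W`. -/
def ParityGraph.attrVerts {V : Type u} (G : ParityGraph V) (W : Set V) : Set V :=
  {v | v ∈ G.verts ∧ ∀ p, G.IsInfPath p → p 0 = v → ∃ k, p k ∈ W} ∪ W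

/-! ### Ordered trees and Strahler numbers -/

/-- Ordered trees: a node has a family of children indexed by the ordinals `0 < k < ℓ`, a
well-ordered set; the leaf is the node without children (`ℓ ≤ 1`). -/
inductive OrderedTree : Type 1
  | node (ℓ : Ordinal.{0}) (T : Set.Ioo (0 : Ordinal.{0}) ℓ → OrderedTree) : OrderedTree

open Classical in
/-- The `n`-Strahler number: `1` for the leaf; otherwise, with `m` the maximum of the
`n`-Strahler numbers of the children, it is `m + 1` if at least `n + 1` children have
`n`-Strahler number `m`, and `m` if not. The values are in `ℕ∞`, so that the supremum is the
maximum whenever the tree has finite depth. -/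
noncomputable def OrderedTree.strahler (n : ℕ) : OrderedTree → ℕ∞
  | .node ℓ T =>
    if IsEmpty (Set.Ioo (0 : Ordinal.{0}) ℓ) then 1
    else
      if ((n + 1 : ℕ) : ℕ∞) ≤
          Set.encard {k | (T k).strahler n = ⨆ k', (T k').strahler n} then
        (⨆ k, (T k).strahler n) + 1
      else ⨆ k, (T k).strahler n

/-! ### Attractor decompositions -/

/-- The data `(H, A₀, (Sₖ, Aₖ, Dₖ)_{0 < k < ℓ})` of an attractor decomposition, with `A₀` written
as `A 0`. The values of `A k` for `k ≥ ℓ > 0`, and of `S k` for `k` outside of the interval, play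
no role. -/
inductive AttrDecomp (V : Type u) : Type (max u 1)
  | mk (H : Set (V × V)) (A : Ordinal.{0} → Set V) (ℓ : Ordinal.{0}) (S : Ordinal.{0} → Set V)
      (D : Set.Ioo (0 : Ordinal.{0}) ℓ → AttrDecomp V) : AttrDecomp V

/-- `D.IsDecompOf κ h G`: `D` is an attractor decomposition of `G` of level `h` and width `κ`.

With `V_k = V \ ⋃_{j < k} A_j` and `G_k = (G \ H) ↾ V_k`, each `S_k` (`0 < k < ℓ ≤ κ`) is a
non-empty subset of `V_k`, closed under successors in `G_k`, such that `(G \ H) ↾ S_k` has no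
terminal vertex and only priorities up to `h - 2` and is decomposed by `D_k`.
At level `0` this forces that there are no children, as `(G \ H) ↾ S_k` would have no edges. At
level `0` or width `0`, the decomposition thus consists of `H` and `A 0`, the whole vertex set. -/
def AttrDecomp.IsDecompOf {V : Type u} (κ : Ordinal.{0}) :
    AttrDecomp V → ℕ → ParityGraph V → Prop
  | .mk H A ℓ S D, h, G =>
    Even h ∧ (∀ e ∈ G.edges, G.label e ≤ h) ∧
    ℓ ≤ κ ∧
    H = {e | e ∈ G.edges ∧ G.label e = h} ∧
    A 0 = G.attrEdges H ∧
    (∀ (k : Ordinal.{0}) (hk : k ∈ Set.Ioo (0 : Ordinal.{0}) ℓ),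
      (S k).Nonempty ∧
      S k ⊆ G.verts \ ⋃ j ∈ Set.Iio k, A j ∧
      (∀ e ∈ ((G.deleteEdges H).restrict (S k)).edges, G.label e + 2 ≤ h) ∧
      ((G.deleteEdges H).restrict (S k)).NoTerminal ∧
      ((G.deleteEdges H).restrict (G.verts \ ⋃ j ∈ Set.Iio k, A j)).SuccClosed (S k) ∧
      A k = ((G.deleteEdges H).restrict (G.verts \ ⋃ j ∈ Set.Iio k, A j)).attrVerts (S k) ∧
      (D ⟨k, hk⟩).IsDecompOf κ (h - 2) ((G.deleteEdges H).restrict (S k))) ∧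
    G.verts = A 0 ∪ ⋃ k ∈ Set.Ioo (0 : Ordinal.{0}) ℓ, A k

/-- The tree-shape of an attractor decomposition. -/
def AttrDecomp.treeShape {V : Type u} : AttrDecomp V → OrderedTree
  | .mk _ _ ℓ _ D => .node ℓ fun k => (D k).treeShape

/-! ### Trees and `n`-bound labellings -/

/-- `G` is a rooted directed tree: for some root without predecessors, every other vertex has
exactly one predecessor, and every vertex is reachable from the root. -/
def IsTreeShaped {V : Type u} (G : Digraph V) : Prop :=
  ∃ r, (∀ v, ¬ G.Adj v r) ∧ (∀ v, v ≠ r → ∃! w, G.Adj w v) ∧ ∀ v, Relation.ReflTransGen G.Adj r v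

/-- Every vertex has finitely many exiting edges. -/
def IsFinitelyBranching {V : Type u} (G : Digraph V) : Prop := ∀ v, {w | G.Adj v w}.Finite

/-- `q` is the maximal label of `L` on the edges number `a, …, b - 1` of the path `p` (which is
only possible if `a < b`). -/
def IsMaxLabel {V : Type u} (L : V × V → ℕ) (p : ℕ → V) (a b q : ℕ) : Prop :=
  IsGreatest ((fun k => L (p k, p (k + 1))) '' Set.Ico a b) q

/-- `L_I` is `n`-bound by `L_J`: there is no finite path `p 0, …, p N` of `G`, cut at
`0 = c 0 ≤ c 1 ≤ … ≤ c (n + 1) = N` into the `n + 1` consecutive paths `π_0, …, π_n`, such that for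
some odd `i` and some even `j` the maximal `L_I`- and `L_J`-labels of each `π_m` are `i` and `j`. -/
def IsBoundBy {V : Type u} (G : Digraph V) (n : ℕ) (L_I L_J : V × V → ℕ) : Prop :=
  ¬ ∃ (p : ℕ → V) (N : ℕ) (c : ℕ → ℕ) (i j : ℕ),
    (∀ k < N, G.Adj (p k) (p (k + 1))) ∧
    c 0 = 0 ∧ Monotone c ∧ c (n + 1) = N ∧
    Odd i ∧ Even j ∧
    ∀ m ≤ n, IsMaxLabel L_I p (c m) (c (m + 1)) i ∧ IsMaxLabel L_J p (c m) (c (m + 1)) j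

/-! Induction on `i`, over all finitely branching graphs without terminal vertices
(`exists_decomp`). With level `2i + 2`, let `K k` be what stage `k` leaves of the graph without its
top edges. If some vertex of `K k` reaches only edges with `ρ ≤ 2i` and `σ ≤ 2j - 2`, let `S k`
consist of all such vertices: by induction its decomposition has Strahler number at most `j - 1`.
Otherwise let `S k` consist of the vertices reaching only `ρ ≤ 2i`, which gives at most `j`.

The root exceeds `j` only if at least `n + 2` stages are of the second kind. A vertex surviving such
a stage reaches an edge with `ρ = 2i + 1` inside `K k`. As `ρ` is even, it can go on to where only
`ρ ≤ 2i` is left; there, as `σ` is even and no vertex is of the first kind, `σ = 2j` is still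
reachable (`exists_walk_top`). Starting at the last of the `n + 2` stages and descending through the
others gives `n + 1` segments with maxima `2i + 1` and `2j`, against the bound.

Finite branching keeps the `S k` free of terminal vertices (`noTerminal_remaining`); countability
makes the stages end by `ω₁`. -/

open Set

/-! ### Reachability, even graphs and segmented walks. -/

namespace ParityGraph

variable {V : Type u}

/-- Reachability along edges. -/
def Reach (K : ParityGraph V) : V → V → Prop :=
  Relation.ReflTransGen fun a b => (a, b) ∈ K.edges

/-- The vertices from which only edges in `Q` can be reached. -/
def safe (K : ParityGraph V) (Q : Set (V × V)) : Set V :=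
  {v | v ∈ K.verts ∧ ∀ x y, K.Reach v x → (x, y) ∈ K.edges → (x, y) ∈ Q}

theorem Reach.mem_verts {K : ParityGraph V} {v w : V} (h : K.Reach v w) (hv : v ∈ K.verts) :
    w ∈ K.verts := by
  induction h with
  | refl => exact hv
  | tail _ h _ => exact (K.edges_subset h).2

theorem mem_safe_of_reach {K : ParityGraph V} {Q : Set (V × V)} {v w : V} (hv : v ∈ K.safe Q)
    (h : K.Reach v w) : w ∈ K.safe Q :=
  ⟨h.mem_verts hv.1, fun x y hx hxy => hv.2 x y (h.trans hx) hxy⟩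

theorem limsup_eq_of_frequently {c : ℕ → ℕ} {p : ℕ} (hle : ∀ k, c k ≤ p)
    (hf : ∀ N, ∃ k ≥ N, p ≤ c k) : limsup c atTop = p := by
  have hb : IsBoundedUnder (· ≤ ·) atTop c := ⟨p, by simpa using ⟨0, fun b _ => hle b⟩⟩
  apply le_antisymm
  · exact limsup_le_of_le (by isBoundedDefault) (Eventually.of_forall hle)
  · exact le_limsup_of_frequently_le (frequently_atTop.2 hf) hb

/-- If a target edge set can be reached again and again, some infinite path visits it infinitely
often. -/
theorem exists_infPath_frequently (K : ParityGraph V) (P : Set (V × V)) (v : V)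
    (h : ∀ u, K.Reach v u → ∃ x y, K.Reach u x ∧ (x, y) ∈ K.edges ∧ (x, y) ∈ P) :
    ∃ p : ℕ → V, K.IsInfPath p ∧ (∀ k, K.Reach v (p k)) ∧
      ∀ N, ∃ k ≥ N, (p k, p (k + 1)) ∈ P := by
  classical
  -- `C m u`: an edge of `P` starts at the end of some walk of length `m` from `u`.
  let C : ℕ → V → Prop := fun m => Nat.rec (fun u => ∃ y, (u, y) ∈ K.edges ∧ (u, y) ∈ P)
    (fun _ C u => ∃ y, (u, y) ∈ K.edges ∧ C y) m
  have hC : ∀ u, K.Reach v u → ∃ m, C m u := by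
    intro u hu
    obtain ⟨x, y, hux, hxy, hP⟩ := h u hu
    clear hu
    induction hux using Relation.ReflTransGen.head_induction_on with
    | refl => exact ⟨0, y, hxy, hP⟩
    | head hab _ ih =>
      obtain ⟨m, hm⟩ := ih
      exact ⟨m + 1, _, hab, hm⟩
  let d : {u // K.Reach v u} → ℕ := fun u => @Nat.find (fun m => C m u.1) (Classical.decPred _) (hC u.1 u.2)
  -- At distance `0` cross an edge of `P`, otherwise step closer to one; the distance cannot
  -- decrease forever, so `P` recurs.
  have hnext : ∀ u : {u // K.Reach v u}, ∃ y : {u // K.Reach v u},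
      (u.1, y.1) ∈ K.edges ∧ ((u.1, y.1) ∈ P ∨ d y < d u) := by
    intro u
    have hd : C (d u) u.1 :=
      @Nat.find_spec (fun m => C m u.1) (Classical.decPred _) (hC u.1 u.2)
    rcases hdu : d u with _ | m
    · rw [hdu] at hd
      obtain ⟨y, hy, hP⟩ := hd
      exact ⟨⟨y, u.2.tail hy⟩, hy, Or.inl hP⟩
    · rw [hdu] at hd
      obtain ⟨y, hy, hm⟩ := hd
      refine ⟨⟨y, u.2.tail hy⟩, hy, Or.inr ?_⟩
      exact Nat.lt_succ_of_le
        (@Nat.find_min' (fun m => C m y) (Classical.decPred _) (hC y (u.2.tail hy)) m hm)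
  choose nx hnx using hnext
  let q : ℕ → {u // K.Reach v u} := fun k => nx^[k] ⟨v, .refl⟩
  have hq : ∀ k, q (k + 1) = nx (q k) := fun k => Function.iterate_succ_apply' _ _ _
  refine ⟨fun k => (q k).1, fun k => ?_, fun k => (q k).2, fun N => ?_⟩
  · change ((q k).1, (q (k + 1)).1) ∈ K.edges
    rw [hq]
    exact (hnx _).1
  · induction hN : d (q N) using Nat.strong_induction_on generalizing N with
    | _ m ih =>
      rcases (hnx (q N)).2 with h | h
      · refine ⟨N, le_rfl, ?_⟩
        change ((q N).1, (q (N + 1)).1) ∈ P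
        rwa [hq]
      · rw [← hq, hN] at h
        obtain ⟨k, hk, hP⟩ := ih _ h (N + 1) rfl
        exact ⟨k, by omega, hP⟩

/-- If the maximal label `p` is odd and all paths are accepting, then from every vertex one can
reach a place from which `p` is no longer seen. -/
theorem exists_reach_lt (K : ParityGraph V) (L : V × V → ℕ) {p : ℕ} (hp : Odd p) (v : V)
    (heven : ∀ q, K.IsInfPath q → ParityAccepting fun k => L (q k, q (k + 1)))
    (hle : ∀ x y, K.Reach v x → (x, y) ∈ K.edges → L (x, y) ≤ p) :
    ∃ u, K.Reach v u ∧ ∀ x y, K.Reach u x → (x, y) ∈ K.edges → L (x, y) < p := by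
  -- Otherwise some path meets `p` infinitely often, and its limit superior is the odd `p`.
  by_contra! hcon
  obtain ⟨q, hq, hr, hf⟩ := K.exists_infPath_frequently {e | p ≤ L e} v (by
    intro u hu
    obtain ⟨x, y, h1, h2, h3⟩ := hcon u hu
    exact ⟨x, y, h1, h2, h3⟩)
  have h := heven q hq
  rw [ParityAccepting, limsup_eq_of_frequently (fun k => hle _ _ (hr k) (hq k)) hf] at h
  exact Nat.not_even_iff_odd.2 hp h

/-! ### Finite walks -/

/-- There is a finite walk from `v` to `w` using all edges in `F`. -/
def HasWalk (K : ParityGraph V) (F : Set (V × V)) (v w : V) : Prop :=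
  ∃ (p : ℕ → V) (N : ℕ), p 0 = v ∧ p N = w ∧ (∀ k < N, (p k, p (k + 1)) ∈ K.edges) ∧
    ∀ e ∈ F, ∃ k < N, (p k, p (k + 1)) = e

theorem HasWalk.refl (K : ParityGraph V) (v : V) : K.HasWalk ∅ v v :=
  ⟨fun _ => v, 0, rfl, rfl, by simp, by simp⟩

theorem HasWalk.cons {K : ParityGraph V} {F : Set (V × V)} {u v w : V} (huv : (u, v) ∈ K.edges)
    (h : K.HasWalk F v w) : K.HasWalk (insert (u, v) F) u w := by
  obtain ⟨p, N, h0, hN, hp, hF⟩ := h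
  refine ⟨fun k => Nat.casesOn k u p, N + 1, rfl, hN, ?_, ?_⟩
  · rintro (_ | k) hk
    · simpa [h0] using huv
    · exact hp k (by omega)
  · rintro e (rfl | he)
    · exact ⟨0, by omega, by simp [h0]⟩
    · obtain ⟨k, hk, rfl⟩ := hF e he
      exact ⟨k + 1, by omega, rfl⟩

theorem HasWalk.of_reach {K : ParityGraph V} {F : Set (V × V)} {u v w : V} (huv : K.Reach u v)
    (h : K.HasWalk F v w) : K.HasWalk F u w := by
  induction huv using Relation.ReflTransGen.head_induction_on with
  | refl => exact h
  | head hab _ ih =>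
    obtain ⟨p, N, h0, hN, hp, hF⟩ := ih.cons hab
    exact ⟨p, N, h0, hN, hp, fun e he => hF e (mem_insert_of_mem _ he)⟩

/-- A walk from `v` segmented into `m` consecutive parts, on each of which the maximal labels
are `a` and `b`. -/
def HasSegments (K : ParityGraph V) (L M : V × V → ℕ) (a b m : ℕ) (v : V) : Prop :=
  ∃ (p : ℕ → V) (c : ℕ → ℕ), p 0 = v ∧ (∀ k < c m, (p k, p (k + 1)) ∈ K.edges) ∧
    c 0 = 0 ∧ Monotone c ∧
    ∀ t < m, IsMaxLabel L p (c t) (c (t + 1)) a ∧ IsMaxLabel M p (c t) (c (t + 1)) b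

theorem HasSegments.zero (K : ParityGraph V) (L M : V × V → ℕ) (a b : ℕ) (v : V) :
    K.HasSegments L M a b 0 v :=
  ⟨fun _ => v, fun _ => 0, rfl, by simp, rfl, fun _ _ _ => le_rfl, by simp⟩

theorem isMaxLabel_of_shift {L : V × V → ℕ} {p q : ℕ → V} {N a b x : ℕ}
    (hpq : ∀ k, q (N + k) = p k) (h : IsMaxLabel L p a b x) :
    IsMaxLabel L q (N + a) (N + b) x := by
  have : (fun k => L (q k, q (k + 1))) '' Ico (N + a) (N + b) =
      (fun k => L (p k, p (k + 1))) '' Ico a b := by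
    rw [← image_const_add_Ico, image_image]
    simp only [hpq, add_assoc]
  rwa [IsMaxLabel, this]

/-- The new first segment lies in the smaller graph `K'`, whose label bounds make `a` and `b` its
maxima; the later segments may leave `K'`. -/
theorem HasSegments.cons {K K' : ParityGraph V} {L M : V × V → ℕ} {a b m : ℕ} {v w : V}
    {e f : V × V} (hsub : K'.edges ⊆ K.edges) (hwalk : K'.HasWalk {e, f} v w)
    (hL : ∀ e ∈ K'.edges, L e ≤ a) (hM : ∀ e ∈ K'.edges, M e ≤ b) (he : L e = a) (hf : M f = b)
    (h : K.HasSegments L M a b m w) : K.HasSegments L M a b (m + 1) v := by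
  obtain ⟨q, N, hq0, hqN, hq, hF⟩ := hwalk
  obtain ⟨p, c, hp0, hp, hc0, hc, hmax⟩ := h
  let r : ℕ → V := fun k => if k < N then q k else p (k - N)
  have hr1 : ∀ k ≤ N, r k = q k := by
    intro k hk
    rcases hk.lt_or_eq with hk | rfl
    · simp [r, hk]
    · simp [r, hp0, hqN]
  have hr2 : ∀ k, r (N + k) = p k := by simp [r]
  have hfirst : ∀ (L : V × V → ℕ) (a : ℕ) (e : V × V), (∀ e ∈ K'.edges, L e ≤ a) →
      L e = a → (∃ k < N, (q k, q (k + 1)) = e) → IsMaxLabel L r 0 N a := by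
    rintro L a e hL he ⟨k, hk, rfl⟩
    refine ⟨⟨k, ⟨by omega, hk⟩, ?_⟩, ?_⟩
    · simp only [hr1 k hk.le, hr1 (k + 1) hk, he]
    · rintro _ ⟨k, ⟨_, hk⟩, rfl⟩
      simp only [hr1 k hk.le, hr1 (k + 1) hk]
      exact hL _ (hq k hk)
  refine ⟨r, fun t => Nat.casesOn t 0 fun t => N + c t, ?_, ?_, rfl, ?_, ?_⟩
  · rw [hr1 0 (by omega), hq0]
  · intro k hk
    change k < N + c m at hk
    rcases lt_or_ge k N with hkN | hkN
    · rw [hr1 k hkN.le, hr1 (k + 1) hkN]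
      exact hsub (hq k hkN)
    · obtain ⟨k, rfl⟩ := Nat.exists_eq_add_of_le hkN
      rw [add_assoc, hr2, hr2]
      exact hp k (by omega)
  · refine monotone_nat_of_le_succ ?_
    rintro (_ | t)
    · exact Nat.zero_le _
    · exact Nat.add_le_add_left (hc (Nat.le_succ t)) N
  · rintro (_ | t) ht
    · simp only [hc0, Nat.add_zero]
      exact ⟨hfirst L a e hL he (hF e (by simp)), hfirst M b f hM hf (hF f (by simp))⟩
    · exact ⟨isMaxLabel_of_shift hr2 (hmax t (by omega)).1,
        isMaxLabel_of_shift hr2 (hmax t (by omega)).2⟩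

end ParityGraph

/-! ### Transfinite peeling -/

/-- What is left of `U` before stage `k`. -/
abbrev remaining {V : Type u} (U : Set V) (A : Ordinal.{0} → Set V) (k : Ordinal.{0}) : Set V :=
  U \ ⋃ j ∈ Iio k, A j

open Classical in
/-- The sequence that starts with `A₀`, each further member being `F` of what is left of `U`. -/
noncomputable def peel {V : Type u} (A₀ U : Set V) (F : Set V → Set V) (k : Ordinal.{0}) : Set V :=
  if k = 0 then A₀ else F (U \ ⋃ j : Iio k, peel A₀ U F j.1)
termination_by k
decreasing_by exact j.2

section Peel

variable {V : Type u}

theorem peel_zero (A₀ U : Set V) (F : Set V → Set V) : peel A₀ U F 0 = A₀ := by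
  rw [peel, if_pos rfl]

theorem peel_of_pos (A₀ U : Set V) (F : Set V → Set V) {k : Ordinal.{0}} (hk : 0 < k) :
    peel A₀ U F k = F (remaining U (peel A₀ U F) k) := by
  rw [peel, if_neg hk.ne', remaining, biUnion_eq_iUnion]

theorem remaining_anti (U : Set V) (A : Ordinal.{0} → Set V) {j k : Ordinal.{0}} (h : j ≤ k) :
    remaining U A k ⊆ remaining U A j :=
  sdiff_subset_sdiff_right (biUnion_subset_biUnion_left (Iio_subset_Iio h))

theorem notMem_of_mem_remaining {U : Set V} {A : Ordinal.{0} → Set V} {j k : Ordinal.{0}} {v : V}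
    (h : j < k) (hv : v ∈ remaining U A k) : v ∉ A j :=
  fun hj => hv.2 (mem_biUnion h hj)

-- The positive stages are disjoint, and nonempty while something remains; `ω₁` of them would inject
-- `Iio ω₁` into the countable `V`.
open scoped Ordinal in
theorem exists_remaining_eq_empty [Countable V] (U : Set V) (A : Ordinal.{0} → Set V)
    (hsub : ∀ k, 0 < k → A k ⊆ remaining U A k)
    (hne : ∀ k, 0 < k → (remaining U A k).Nonempty → (A k).Nonempty) :
    ∃ ℓ, 0 < ℓ ∧ ℓ ≤ ω₁ ∧ remaining U A ℓ = ∅ ∧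
      ∀ k, 0 < k → k < ℓ → (remaining U A k).Nonempty := by
  have hex : ∃ ℓ, 0 < ℓ ∧ ℓ ≤ ω₁ ∧ remaining U A ℓ = ∅ := by
    by_contra! hcon
    -- The successor avoids stage `0`, about which nothing is assumed.
    have hn : ∀ k : Iio (ω₁ : Ordinal.{0}), ∃ v, v ∈ A (Order.succ k.1) := fun k =>
      hne _ (Order.bot_lt_succ k.1) (hcon _ (Order.bot_lt_succ k.1) (Order.succ_le_of_lt k.2))
    choose f hf using hn
    have hlt : ∀ j k : Iio (ω₁ : Ordinal.{0}), j.1 < k.1 → f j ≠ f k := by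
      intro j k hjk h
      exact notMem_of_mem_remaining (Order.succ_lt_succ hjk)
        (hsub _ (Order.bot_lt_succ k.1) (hf k)) (h ▸ hf j)
    have hinj : Function.Injective f := by
      intro j k h
      by_contra hjk
      rcases lt_or_gt_of_ne (fun h' => hjk (Subtype.ext h')) with h' | h'
      · exact hlt j k h' h
      · exact hlt k j h' h.symm
    have hc : Countable (Iio (ω₁ : Ordinal.{0})) := hinj.countable
    have := Cardinal.mk_le_aleph0_iff.2 hc
    rw [Cardinal.mk_Iio_ordinal] at this
    simp at this
  obtain ⟨ℓ, ⟨hl1, hl2, hl3⟩, hmin⟩ := wellFounded_lt.has_min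
    {ℓ : Ordinal.{0} | 0 < ℓ ∧ ℓ ≤ ω₁ ∧ remaining U A ℓ = ∅} hex
  refine ⟨ℓ, hl1, hl2, hl3, fun k hk hkl => ?_⟩
  by_contra hcon
  exact hmin k ⟨hk, hkl.le.trans hl2, not_nonempty_iff_eq_empty.1 hcon⟩ hkl

end Peel

/-! ### Walks and terminal vertices in the remaining graphs. -/

namespace ParityGraph

variable {V : Type u}

theorem IsInfPath.mono {K G : ParityGraph V} (h : K.edges ⊆ G.edges) {p : ℕ → V}
    (hp : K.IsInfPath p) : G.IsInfPath p := fun k => h (hp k)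

theorem IsInfPath.tail {K : ParityGraph V} {p : ℕ → V} (hp : K.IsInfPath p) :
    K.IsInfPath fun k => p (k + 1) := fun k => hp (k + 1)

/-- The restriction to `W` of the graph without its edges of priority `h`. -/
abbrev below (G : ParityGraph V) (h : ℕ) (W : Set V) : ParityGraph V :=
  (G.deleteEdges {e | e ∈ G.edges ∧ G.label e = h}).restrict W

theorem below_edges_subset (G : ParityGraph V) (h : ℕ) (W : Set V) :
    (G.below h W).edges ⊆ G.edges := fun _ he => he.1.1

theorem label_lt_of_mem_below {G : ParityGraph V} {h : ℕ} {W : Set V}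
    (hle : ∀ e ∈ G.edges, G.label e ≤ h) {e : V × V} (he : e ∈ (G.below h W).edges) :
    G.label e < h :=
  lt_of_le_of_ne (hle e he.1.1) fun heq => he.1.2 ⟨he.1.1, heq⟩

theorem attrVerts_subset_verts {K : ParityGraph V} {S : Set V} (hS : S ⊆ K.verts) :
    K.attrVerts S ⊆ K.verts :=
  union_subset (fun _ hv => hv.1) hS

theorem exists_reach_mem_safe {K : ParityGraph V} {i : ℕ} (hK : K.IsEven)
    (hle : ∀ e ∈ K.edges, K.label e ≤ 2 * i + 1) {v : V} (hv : v ∈ K.verts) :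
    ∃ u, K.Reach v u ∧ u ∈ K.safe {e | K.label e ≤ 2 * i} := by
  obtain ⟨u, hu, hlt⟩ := K.exists_reach_lt K.label ⟨i, rfl⟩ v hK fun x y _ h => hle _ h
  exact ⟨u, hu, hu.mem_verts hv, fun x y hx hxy => Nat.lt_succ_iff.1 (hlt x y hx hxy)⟩

/-- Without `2j`, the largest value of `σ` is at most the odd `2j - 1`, which evenness lets one
escape; beyond it `σ ≤ 2j - 2`, against `hbig`. -/
theorem exists_reach_top {K : ParityGraph V} {σ : V × V → ℕ} {i j : ℕ} (hj : 1 ≤ j)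
    (hσ : ∀ q, K.IsInfPath q → ParityAccepting fun k => σ (q k, q (k + 1)))
    (hσle : ∀ e ∈ K.edges, σ e ≤ 2 * j)
    (hbig : K.safe {e | K.label e ≤ 2 * i ∧ σ e + 2 ≤ 2 * j} = ∅) {u : V}
    (hu : u ∈ K.safe {e | K.label e ≤ 2 * i}) :
    ∃ x y, K.Reach u x ∧ (x, y) ∈ K.edges ∧ σ (x, y) = 2 * j := by
  by_contra! hcon
  obtain ⟨w, hw, hlt⟩ := K.exists_reach_lt σ (p := 2 * j - 1) ⟨j - 1, by omega⟩ u hσ (by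
    intro x y hx hxy
    have h1 := hcon x y hx hxy
    have h2 := hσle _ hxy
    omega)
  have hmem : w ∈ K.safe {e | K.label e ≤ 2 * i ∧ σ e + 2 ≤ 2 * j} :=
    ⟨hw.mem_verts hu.1, fun x y hx hxy => ⟨(mem_safe_of_reach hu hw).2 x y hx hxy, by
      have := hlt x y hx hxy
      omega⟩⟩
  rw [hbig] at hmem
  exact hmem

theorem exists_walk_top {K : ParityGraph V} {σ : V × V → ℕ} {i j : ℕ} (hj : 1 ≤ j)
    (hK : K.IsEven) (hle : ∀ e ∈ K.edges, K.label e ≤ 2 * i + 1)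
    (hσ : ∀ q, K.IsInfPath q → ParityAccepting fun k => σ (q k, q (k + 1)))
    (hσle : ∀ e ∈ K.edges, σ e ≤ 2 * j)
    (hbig : K.safe {e | K.label e ≤ 2 * i ∧ σ e + 2 ≤ 2 * j} = ∅) {v : V}
    (hv : v ∈ K.verts) (hv' : v ∉ K.safe {e | K.label e ≤ 2 * i}) :
    ∃ w ∈ K.verts, ∃ e f, K.label e = 2 * i + 1 ∧ σ f = 2 * j ∧ K.HasWalk {e, f} v w := by
  have : ∃ x y, K.Reach v x ∧ (x, y) ∈ K.edges ∧ 2 * i < K.label (x, y) := by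
    by_contra! hcon
    exact hv' ⟨hv, hcon⟩
  obtain ⟨x, y, hvx, hxy, hlt⟩ := this
  obtain ⟨u, hyu, hu⟩ := exists_reach_mem_safe hK hle (K.edges_subset hxy).2
  obtain ⟨x', y', hux, hxy', htop⟩ := exists_reach_top hj hσ hσle hbig hu
  refine ⟨y', (K.edges_subset hxy').2, (x, y), (x', y'), ?_, htop, ?_⟩
  · have := hle _ hxy
    omega
  -- The walk is assembled backwards from its end `y'`.
  · have := (((((HasWalk.refl K y').cons hxy').of_reach hux).of_reach hyu).cons hxy).of_reach hvx
    rwa [insert_empty_eq] at this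

/-- Finite branching keeps the remaining graphs free of terminal vertices. -/
theorem noTerminal_remaining {G : ParityGraph V} {h : ℕ}
    (hfin : ∀ v, {w | (v, w) ∈ G.edges}.Finite) {A S : Ordinal.{0} → Set V}
    (hA₀ : A 0 = G.attrEdges {e | e ∈ G.edges ∧ G.label e = h})
    (hA : ∀ k, 0 < k → A k = (G.below h (remaining G.verts A k)).attrVerts (S k))
    {k : Ordinal.{0}} (hk : 0 < k) {v : V} (hv : v ∈ remaining G.verts A k) :
    ∃ w, (v, w) ∈ (G.below h (remaining G.verts A k)).edges := by
  by_contra! hcon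
  -- `t w` is a stage that removed `w`; the value `0` is a dummy unless `w` is a successor by an
  -- edge of priority other than `h`.
  have hidx : ∀ w, ∃ t, t < k ∧ ((v, w) ∈ G.edges → G.label (v, w) ≠ h → w ∈ A t) := by
    intro w
    by_cases hw : (v, w) ∈ G.edges ∧ G.label (v, w) ≠ h
    · by_contra! hw'
      refine hcon w ⟨⟨hw.1, fun hmem => hw.2 hmem.2⟩, hv, (G.edges_subset hw.1).2, ?_⟩
      simp only [mem_iUnion, not_exists]
      exact fun t ht => (hw' t ht).2.2
    · exact ⟨0, hk, fun h1 h2 => absurd ⟨h1, h2⟩ hw⟩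
  choose t htk ht using hidx
  -- Finitely many successors, so a single stage `m < k` bounds all their stages; then `v` itself
  -- was attracted by stage `m`.
  obtain ⟨m, hmk, hm⟩ : ∃ m < k, ∀ w, (v, w) ∈ G.edges → t w ≤ m := by
    rcases {w | (v, w) ∈ G.edges}.eq_empty_or_nonempty with he | hne
    · refine ⟨0, hk, fun w hw => ?_⟩
      have : w ∈ {w | (v, w) ∈ G.edges} := hw
      rw [he] at this
      exact this.elim
    · obtain ⟨w, _, hw⟩ := (hfin v).exists_maximalFor t _ hne
      refine ⟨t w, htk w, fun w' hw' => ?_⟩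
      exact (le_total (t w') (t w)).elim id fun hle => hw hw' hle
  refine notMem_of_mem_remaining hmk hv ?_
  rcases eq_or_ne m 0 with rfl | hm0
  · rw [hA₀]
    refine ⟨hv.1, fun p hp hp0 => ?_⟩
    subst hp0
    by_cases hl : G.label (p 0, p 1) = h
    · exact ⟨0, hp 0, hl⟩
    · have hw := ht (p 1) (hp 0) hl
      rw [nonpos_iff_eq_zero.1 (hm _ (hp 0)), hA₀] at hw
      obtain ⟨l, hl⟩ := hw.2 _ hp.tail rfl
      exact ⟨l + 1, hl⟩
  · have hmpos : 0 < m := pos_iff_ne_zero.2 hm0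
    rw [hA m hmpos]
    refine Or.inl ⟨⟨hv.1, remaining_anti _ _ hmk.le hv⟩, fun p hp hp0 => ?_⟩
    subst hp0
    have hp1 := hp 0
    have hw := ht (p 1) hp1.1.1 fun hl => hp1.1.2 ⟨hp1.1.1, hl⟩
    have hle := hm (p 1) hp1.1.1
    -- The path stays in what remains at stage `m`, so its next vertex was not removed earlier.
    have heq : t (p 1) = m := by
      refine hle.eq_of_not_lt fun hlt => ?_
      exact notMem_of_mem_remaining hlt hp1.2.2 hw
    rw [heq, hA m hmpos] at hw
    rcases hw with hw | hw
    · obtain ⟨l, hl⟩ := hw.2 _ hp.tail rfl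
      exact ⟨l + 1, hl⟩
    · exact ⟨1, hw⟩

theorem attrEdges_eq_verts {G : ParityGraph V} {h : ℕ} (hG : ∀ e ∈ G.edges, G.label e = h) :
    G.attrEdges {e | e ∈ G.edges ∧ G.label e = h} = G.verts :=
  subset_antisymm (fun _ hv => hv.1) fun _ hv => ⟨hv, fun _ hp _ => ⟨0, hp 0, hG _ (hp 0)⟩⟩

end ParityGraph

/-! ### Strahler bounds and the chaining of segments. -/

theorem strahler_le_of_children {n j : ℕ} {ℓ : Ordinal.{0}}
    {T : Ioo (0 : Ordinal.{0}) ℓ → OrderedTree} (hj : 1 ≤ j)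
    (hle : ∀ k, (T k).strahler n ≤ j)
    (hcard : {k | (j : ℕ∞) ≤ (T k).strahler n}.encard < (n + 1 : ℕ)) :
    (OrderedTree.node ℓ T).strahler n ≤ j := by
  have hsup : ⨆ k, (T k).strahler n ≤ j := iSup_le hle
  rw [OrderedTree.strahler]
  split_ifs with h1 h2
  · exact_mod_cast hj
  -- A supremum below `j` leaves room for `+ 1`; a supremum equal to `j` is attained too rarely to
  -- add `1`.
  · rcases hsup.lt_or_eq with hlt | heq
    · exact Order.add_one_le_of_lt hlt
    · refine absurd (h2.trans (encard_le_encard ?_)) (not_le.2 hcard)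
      intro k hk
      rw [mem_ofPred_eq, heq] at hk
      exact hk.ge
  · exact hsup

/-- Segments along a descending sequence of stages at which a long walk can be made. -/
theorem ParityGraph.hasSegments_of_card {V : Type u} {G : ParityGraph V} {σ : V × V → ℕ} {a b : ℕ}
    {R : Ordinal.{0} → Set V} {B : Set Ordinal.{0}}
    (hstep : ∀ k ∈ B, ∀ k', k < k' → ∀ v ∈ R k', ∃ w ∈ R k, ∀ m,
      G.HasSegments G.label σ a b m w → G.HasSegments G.label σ a b (m + 1) v)
    (m : ℕ) {k' : Ordinal.{0}} {v : V} (hv : v ∈ R k') (s : Finset Ordinal.{0})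
    (hs : ↑s ⊆ B ∩ Iio k') (hm : s.card = m) : G.HasSegments G.label σ a b m v := by
  induction m generalizing k' v s with
  | zero => exact .zero ..
  | succ m ih =>
    have hne : s.Nonempty := Finset.card_pos.1 (by omega)
    have hmax := s.max'_mem hne
    obtain ⟨w, hw, hseg⟩ := hstep _ (hs hmax).1 _ (hs hmax).2 v hv
    refine hseg m (ih hw (s.erase (s.max' hne)) ?_ ?_)
    · intro x hx
      rw [Finset.mem_coe] at hx
      exact ⟨(hs (Finset.mem_of_mem_erase hx)).1, s.lt_max'_of_mem_erase_max' hne hx⟩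
    · rw [Finset.card_erase_of_mem hmax, hm, Nat.add_sub_cancel]

/-! ### Construction of the decomposition. -/

namespace ParityGraph

variable {V : Type u}

theorem HasSegments.mono {K G : ParityGraph V} (h : K.edges ⊆ G.edges) {L M : V × V → ℕ}
    {a b m : ℕ} {v : V} (hK : K.HasSegments L M a b m v) : G.HasSegments L M a b m v := by
  obtain ⟨p, c, h0, hp, hc⟩ := hK
  exact ⟨p, c, h0, fun k hk => h (hp k hk), hc⟩

open Classical in
/-- The next successor-closed set of a decomposition: the part on which both labellings have
smaller priorities if it is non-empty, and the part on which `K.label` has if not. -/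
noncomputable def core (K : ParityGraph V) (σ : V × V → ℕ) (i j : ℕ) : Set V :=
  if (K.safe {e | K.label e ≤ 2 * i ∧ σ e + 2 ≤ 2 * j}).Nonempty then
    K.safe {e | K.label e ≤ 2 * i ∧ σ e + 2 ≤ 2 * j}
  else K.safe {e | K.label e ≤ 2 * i}

theorem core_subset (K : ParityGraph V) (σ : V × V → ℕ) (i j : ℕ) :
    K.core σ i j ⊆ K.safe {e | K.label e ≤ 2 * i} := by
  rw [core]
  split_ifs
  · exact fun v hv => ⟨hv.1, fun x y hx hxy => (hv.2 x y hx hxy).1⟩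
  · exact subset_rfl

theorem core_nonempty {K : ParityGraph V} (σ : V × V → ℕ) {i : ℕ} (j : ℕ) (hK : K.IsEven)
    (hle : ∀ e ∈ K.edges, K.label e ≤ 2 * i + 1) (hne : K.verts.Nonempty) :
    (K.core σ i j).Nonempty := by
  rw [core]
  split_ifs with h
  · exact h
  · obtain ⟨v, hv⟩ := hne
    obtain ⟨u, _, hu⟩ := exists_reach_mem_safe hK hle hv
    exact ⟨u, hu⟩

theorem core_succClosed (K : ParityGraph V) (σ : V × V → ℕ) (i j : ℕ) :
    K.SuccClosed (K.core σ i j) := by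
  rw [core]
  split_ifs <;> exact fun v hv w hvw => mem_safe_of_reach hv (.single hvw)

theorem exists_decomp [Countable V] (n i : ℕ) : ∀ (j : ℕ) (G : ParityGraph V) (σ : V × V → ℕ),
    (∀ v, {w | (v, w) ∈ G.edges}.Finite) → G.NoTerminal → G.verts.Nonempty →
    (∀ e ∈ G.edges, G.label e ≤ 2 * i) → (∀ e ∈ G.edges, 1 ≤ σ e ∧ σ e ≤ 2 * j) → G.IsEven →
    (∀ q, G.IsInfPath q → ParityAccepting fun k => σ (q k, q (k + 1))) →
    (∀ a b v, Odd a → Even b → ¬ G.HasSegments G.label σ a b (n + 1) v) →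
    ∃ D : AttrDecomp V, D.IsDecompOf (Ordinal.omega 1) (2 * i) G ∧
      D.treeShape.strahler (n + 1) ≤ j := by
  induction i with
  | zero =>
    intro j G σ _ hterm hne hle hσ _ _ _
    -- Some edge exists, and its `σ`-label lies in `[1, 2j]`.
    have hj : 1 ≤ j := by
      obtain ⟨v, hv⟩ := hne
      obtain ⟨w, hw⟩ := hterm v hv
      have := hσ _ hw
      omega
    have hempty : IsEmpty (Ioo (0 : Ordinal.{0}) 0) := ⟨fun k => lt_irrefl _ (k.2.1.trans k.2.2)⟩
    refine ⟨.mk {e | e ∈ G.edges ∧ G.label e = 0} (fun _ => G.verts) 0 (fun _ => ∅)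
      (fun k => hempty.elim k), ?_, ?_⟩
    · rw [AttrDecomp.IsDecompOf]
      refine ⟨by simp, hle, zero_le, rfl, ?_, fun k hk => hempty.elim ⟨k, hk⟩, ?_⟩
      · exact (attrEdges_eq_verts fun e he => Nat.le_zero.1 (hle e he)).symm
      · simp
    · rw [AttrDecomp.treeShape]
      refine strahler_le_of_children hj (fun k => hempty.elim k) ?_
      rw [eq_empty_of_isEmpty {k | _}, encard_empty]
      exact_mod_cast Nat.succ_pos _
  | succ i ih =>
    intro j G σ hfin hterm hne hle hσ heven hσeven hbound
    have hj : 1 ≤ j := by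
      obtain ⟨v, hv⟩ := hne
      obtain ⟨w, hw⟩ := hterm v hv
      have := hσ _ hw
      omega
    set h := 2 * (i + 1) with hh
    let H : Set (V × V) := {e | e ∈ G.edges ∧ G.label e = h}
    let F : Set V → Set V := fun W => (G.below h W).attrVerts ((G.below h W).core σ i j)
    let A := peel (G.attrEdges H) G.verts F
    let K : Ordinal.{0} → ParityGraph V := fun k => G.below h (remaining G.verts A k)
    let S : Ordinal.{0} → Set V := fun k => (K k).core σ i j
    have hA₀ : A 0 = G.attrEdges H := peel_zero _ _ _
    have hA : ∀ k, 0 < k → A k = (K k).attrVerts (S k) := fun k hk => peel_of_pos _ _ _ hk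
    have hsubE : ∀ W, (G.below h W).edges ⊆ G.edges := G.below_edges_subset h
    have hevenB : ∀ W, (G.below h W).IsEven := fun W q hq => heven q (hq.mono (hsubE W))
    have hσevenB : ∀ W q, (G.below h W).IsInfPath q →
        ParityAccepting fun k => σ (q k, q (k + 1)) := fun W q hq => hσeven q (hq.mono (hsubE W))
    have hleB : ∀ W, ∀ e ∈ (G.below h W).edges, G.label e ≤ 2 * i + 1 := by
      intro W e he
      have := label_lt_of_mem_below hle he
      omega
    have hverts : ∀ k, (K k).verts = remaining G.verts A k := fun k =>
      inter_eq_right.2 sdiff_subset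
    have hsafe : ∀ k, S k ⊆ (K k).safe {e | G.label e ≤ 2 * i} := fun k => core_subset _ _ _ _
    have hSsub : ∀ k, S k ⊆ remaining G.verts A k := fun k v hv => hverts k ▸ (hsafe k hv).1
    have hSne : ∀ k, (remaining G.verts A k).Nonempty → (S k).Nonempty := fun k hk =>
      core_nonempty σ j (hevenB _) (hleB _) ((hverts k).symm ▸ hk)
    obtain ⟨ℓ, hℓ0, hℓω, hℓ, hℓne⟩ := exists_remaining_eq_empty G.verts A
      (fun k hk => by
        rw [hA k hk]
        refine (attrVerts_subset_verts ?_).trans (hverts k).subset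
        rw [hverts]
        exact hSsub k)
      (fun k hk hr => by
        rw [hA k hk]
        exact (hSne k hr).mono subset_union_right)
    have hchildE : ∀ k, (G.below h (S k)).edges ⊆ (K k).edges := fun k e he =>
      ⟨he.1, hSsub k he.2.1, hSsub k he.2.2⟩
    have hclosed : ∀ k, (K k).SuccClosed (S k) := fun k => core_succClosed _ _ _ _
    have hchildLe : ∀ k, ∀ e ∈ (G.below h (S k)).edges, G.label e ≤ 2 * i := fun k e he =>
      (hsafe k he.2.1).2 e.1 e.2 .refl (hchildE k he)
    have hchildTerm : ∀ k, 0 < k → (G.below h (S k)).NoTerminal := by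
      rintro k hk v ⟨_, hv⟩
      obtain ⟨w, hw⟩ := noTerminal_remaining hfin hA₀ hA hk (hSsub k hv)
      exact ⟨w, hw.1, hv, hclosed k v hv w hw⟩
    have hchild : ∀ k : Ioo (0 : Ordinal.{0}) ℓ, ∀ j',
        (∀ e ∈ (G.below h (S k)).edges, σ e ≤ 2 * j') →
        ∃ D : AttrDecomp V, D.IsDecompOf (Ordinal.omega 1) (2 * i) (G.below h (S k)) ∧
          D.treeShape.strahler (n + 1) ≤ j' := by
      intro k j' hj'
      refine ih j' (G.below h (S k)) σ (fun v => (hfin v).subset fun w hw => hsubE _ hw)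
        (hchildTerm k k.2.1) ?_ (hchildLe k) (fun e he => ⟨(hσ e (hsubE _ he)).1, hj' e he⟩)
        (hevenB _) (hσevenB _) fun a b v ha hb hseg =>
          hbound a b v ha hb (hseg.mono (hsubE _))
      obtain ⟨v, hv⟩ := hSne k (hℓne k k.2.1 k.2.2)
      exact ⟨v, (hSsub k hv).1, hv⟩
    -- The stages of the first kind, whose children get Strahler number below `j`.
    let small : Set Ordinal.{0} :=
      {k | ((K k).safe {e | G.label e ≤ 2 * i ∧ σ e + 2 ≤ 2 * j}).Nonempty}
    have hexD : ∀ k : Ioo (0 : Ordinal.{0}) ℓ, ∃ D : AttrDecomp V,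
        D.IsDecompOf (Ordinal.omega 1) (2 * i) (G.below h (S k)) ∧
          D.treeShape.strahler (n + 1) ≤ j ∧
          (k.1 ∈ small → D.treeShape.strahler (n + 1) < j) := by
      intro k
      by_cases hk : k.1 ∈ small
      · have hS : S k = (K k).safe {e | G.label e ≤ 2 * i ∧ σ e + 2 ≤ 2 * j} := if_pos hk
        obtain ⟨D, hD, hDj⟩ := hchild k (j - 1) fun e he => by
          have h1 : e.1 ∈ (K k).safe {e | G.label e ≤ 2 * i ∧ σ e + 2 ≤ 2 * j} := hS ▸ he.2.1
          have h2 : σ e + 2 ≤ 2 * j := (h1.2 e.1 e.2 .refl (hchildE k he)).2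
          omega
        have hlt : D.treeShape.strahler (n + 1) < j :=
          hDj.trans_lt (by exact_mod_cast Nat.sub_lt hj one_pos)
        exact ⟨D, hD, hlt.le, fun _ => hlt⟩
      · obtain ⟨D, hD, hDj⟩ := hchild k j fun e he => (hσ e (hsubE _ he)).2
        exact ⟨D, hD, hDj, fun hk' => absurd hk' hk⟩
    choose D hD hDle hDlt using hexD
    refine ⟨.mk H A ℓ S D, ?_, ?_⟩
    · rw [AttrDecomp.IsDecompOf]
      refine ⟨⟨i + 1, by omega⟩, hle, hℓω, rfl, hA₀, fun k hk => ⟨hSne k (hℓne k hk.1 hk.2),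
        hSsub k, fun e he => ?_, hchildTerm k hk.1, hclosed k, hA k hk.1, hD ⟨k, hk⟩⟩, ?_⟩
      · have := hchildLe k e he
        change G.label e + 2 ≤ h
        omega
      · refine subset_antisymm (fun v hv => ?_) (union_subset ?_ (iUnion₂_subset fun k hk => ?_))
        · by_contra hcon
          have : v ∈ remaining G.verts A ℓ := by
            refine ⟨hv, fun hmem => hcon ?_⟩
            obtain ⟨k, hk, hvk⟩ := mem_iUnion₂.1 hmem
            rcases eq_or_ne k 0 with rfl | hk0
            · exact Or.inl hvk
            · exact Or.inr (mem_biUnion ⟨pos_iff_ne_zero.2 hk0, hk⟩ hvk)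
          rw [hℓ] at this
          exact this
        · rw [hA₀]
          exact fun v hv => hv.1
        · rw [hA k hk.1]
          refine (attrVerts_subset_verts ((hsafe k).trans fun v hv => hv.1)).trans ?_
          exact inter_subset_left
    · rw [AttrDecomp.treeShape]
      refine strahler_le_of_children hj hDle ?_
      by_contra! hcard
      -- Only stages outside `small` can have a child with number `j`.
      have hcard' : ((n + 1 + 1 : ℕ) : ℕ∞) ≤ (smallᶜ ∩ Ioo 0 ℓ).encard := by
        refine hcard.trans ?_
        rw [← Subtype.val_injective.encard_image]
        refine encard_le_encard ?_
        rintro _ ⟨k, hk, rfl⟩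
        exact ⟨fun hs => absurd (hDlt k hs) (not_lt.2 hk), k.2⟩
      obtain ⟨s, hs, hscard⟩ := exists_subset_encard_eq hcard'
      have hsfin : s.Finite := finite_of_encard_eq_coe hscard
      lift s to Finset Ordinal.{0} using hsfin
      rw [encard_coe_eq_coe_finsetCard] at hscard
      have hscard : s.card = n + 1 + 1 := by exact_mod_cast hscard
      have hsne : s.Nonempty := Finset.card_pos.1 (by omega)
      have hmax := s.max'_mem hsne
      -- The largest of the `n + 2` stages only supplies the starting vertex; each of the other `n +
      -- 1` supplies a segment.
      obtain ⟨v, hv⟩ := hℓne _ (hs hmax).2.1 (hs hmax).2.2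
      refine hbound (2 * i + 1) (2 * j) v ⟨i, rfl⟩ ⟨j, by omega⟩
        (hasSegments_of_card (R := remaining G.verts A) (B := smallᶜ ∩ Ioo 0 ℓ) ?_ (n + 1) hv
          (s.erase (s.max' hsne)) ?_ ?_)
      · rintro k ⟨hk, hkI⟩ k' hkk' u hu
        have hSk : S k = (K k).safe {e | G.label e ≤ 2 * i} := if_neg hk
        -- `u` survives past stage `k`, whose attractor contains `S k`.
        have huS : u ∉ (K k).safe {e | G.label e ≤ 2 * i} := by
          rw [← hSk]
          intro hmem
          refine notMem_of_mem_remaining hkk' hu ?_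
          rw [hA k hkI.1]
          exact Or.inr hmem
        obtain ⟨w, hw, e, f, he, hf, hwalk⟩ := exists_walk_top (K := K k) hj (hevenB _) (hleB _)
          (hσevenB _) (fun e he => (hσ e (hsubE _ he)).2) (not_nonempty_iff_eq_empty.1 hk)
          ((hverts k).symm ▸ remaining_anti _ _ hkk'.le hu) huS
        exact ⟨w, hverts k ▸ hw, fun m hm => hm.cons (hsubE _) hwalk (hleB _)
          (fun e he => (hσ e (hsubE _ he)).2) he hf⟩
      · intro x hx
        rw [Finset.mem_coe] at hx
        exact ⟨hs (Finset.mem_of_mem_erase hx), s.lt_max'_of_mem_erase_max' hsne hx⟩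
      · rw [Finset.card_erase_of_mem hmax, hscard, Nat.add_sub_cancel]

end ParityGraph

theorem mainTheorem4 {V : Type*} [Countable V] (G : Digraph V)
    (hTree : IsTreeShaped G) (hFin : IsFinitelyBranching G) (hTerm : ∀ v, ∃ w, G.Adj v w)
    (i j n : ℕ) (ρ σ : V × V → ℕ)
    (hρI : (ParityGraph.ofDigraph G ρ).HasIndex 0 (2 * i))
    (hσJ : (ParityGraph.ofDigraph G σ).HasIndex 1 (2 * j))
    (hρ : (ParityGraph.ofDigraph G ρ).IsEven)
    (hσ : (ParityGraph.ofDigraph G σ).IsEven)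
    (hBound : IsBoundBy G n ρ σ) :
    ∃ (κ : Ordinal.{0}) (D : AttrDecomp V),
      D.IsDecompOf κ (2 * i) (ParityGraph.ofDigraph G ρ) ∧
      D.treeShape.strahler (n + 1) ≤ (j : ℕ∞) := by
  obtain ⟨r, _⟩ := hTree
  refine ⟨Ordinal.omega 1, ParityGraph.exists_decomp n i j (.ofDigraph G ρ) σ hFin
    (fun v _ => hTerm v) ⟨r, mem_univ r⟩ (fun e he => (hρI e he).2) hσJ hρ hσ ?_⟩
  rintro a b v ha hb ⟨p, c, _, hp, hc0, hc, hmax⟩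
  exact hBound ⟨p, c (n + 1), c, a, b, hp, hc0, hc, rfl, ha, hb, fun m hm =>
    hmax m (Nat.lt_succ_of_le hm)⟩
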